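/- Let $G$ be a commutative group, let all rings be commutative, and let $h\colon R\to S$ be a morphism of $G$-graded rings (a ring homomorphism with $h(R_g)\subseteq S_g$ for all $g\in G$). For a $G$-graded ring $A$ let $\mathsf{Mod}^G(A)$ be the category of $G$-graded $A$-modules with degree-preserving $A$-linear maps as morphisms. For $M,N\in\mathsf{Mod}^G(A)$ let $M\otimes_A N$ carry the grading whose degree $g$ part is generated by the elements $x\otimes y$ with $x\in M_i$, $y\in N_j$, $i+j=g$, and let $\mathrm{HOM}_A(M,N)=\bigoplus_{g\in G}\mathrm{Hom}_{\mathsf{Mod}^G(A)}(M,N(g))$, where $N(g)_i=N_{i+g}$, be the $G$-graded $A$-module of finite sums of homogeneous $A$-linear maps $M\to N$. Let $h_*\colon\mathsf{Mod}^G(S)\to\mathsf{Mod}^G(R)$ be scalar restriction, let $h^*=S\otimes_R\bullet\colon\mathsf{Mod}^G(R)\to\mathsf{Mod}^G(S)$ be scalar extension, and let $\widetilde h=\mathrm{HOM}_R(S,\bullet)\colon\mathsf{Mod}^G(R)\to\mathsf{Mod}^G(S)$ be scalar coextension, with $S$-action $(su)(x)=u(sx)$. There are adjunctions $(h^*,h_*)$,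 with unit $x\mapsto 1\otimes x$ and counit $$\sigma^h\colon h^*\circ h_*\to\mathrm{Id},\qquad \sigma^h_N\colon S\otimes_R h_*(N)\to N,\ s\otimes x\mapsto sx,$$ and $(h_*,\widetilde h)$, with counit $u\mapsto u(1)$ and unit $$\widetilde\rho^h\colon \mathrm{Id}\to\widetilde h\circ h_*,\qquad \widetilde\rho^h_N\colon N\to\mathrm{HOM}_R(S,h_*(N)),\ x\mapsto(s\mapsto sx).$$ Moreover, there are morphisms of bifunctors $$\gamma^h_{M,N}\colon h_*(M)\otimes_R h_*(N)\to h_*(M\otimes_S N),\ x\otimes y\mapsto x\otimes y,$$ $$\eta^h_{M,N}\colon h_*(\mathrm{HOM}_S(M,N))\to\mathrm{HOM}_R(h_*(M),h_*(N)),\ u\mapsto u,$$ for $M,N\in\mathsf{Mod}^G(S)$. Then the following statements are equivalent: (i) $h$ is an epimorphism in the category of $G$-graded rings; (ii) $\sigma^h_S\colon S\otimes_R S\to S$ is an isomorphism; (iii) $\sigma^h$ is an isomorphism; (iv) $\widetilde\rho^h$ is an isomorphism; (v) $\gamma^h$ is an isomorphism of bifunctors; (vi) $\eta^h$ is an isomorphism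 of bifunctors; (vii) $\eta^h_{S,\bullet}$ is an isomorphism of functors. -/

import Mathlib

universe v u

open CategoryTheory Opposite
open scoped DirectSum TensorProduct

/-! ### Gradings on tensor products and on modules of linear maps -/

namespace GradedChange

section Internal

variable {G : Type*} [DecidableEq G] {T : Type*} [AddCommGroup T]

/-- A family of subgroups that spans, and whose members are separated by an additive map into
finitely supported functions, is a direct sum decomposition. -/
theorem isInternal_of_map (𝒯 : G → AddSubgroup T) (c : T →+ (G →₀ T))
    (hc : ∀ g, ∀ t ∈ 𝒯 g, c t = Finsupp.single g t) (hs : ⨆ g, 𝒯 g = ⊤) :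
    DirectSum.IsInternal 𝒯 := by
  have key : ∀ (x : ⨁ g, 𝒯 g) (g : G),
      c (DirectSum.coeAddMonoidHom 𝒯 x) g = (x g : T) := by
    intro x g
    induction x using DirectSum.induction_on with
    | zero => simp
    | of i a =>
      rw [DirectSum.coeAddMonoidHom_of, hc i a a.2]
      by_cases hi : i = g
      · subst hi; simp
      · rw [DirectSum.of_eq_of_ne _ _ _ (Ne.symm hi)]; simp [hi]
    | add x y hx hy => simp [hx, hy]
  constructor
  · rw [injective_iff_map_eq_zero]
    intro x hx
    ext g
    rw [← key x g, hx]; simp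
  · have : (⊤ : AddSubgroup T) ≤ (DirectSum.coeAddMonoidHom 𝒯).range := by
      rw [← hs]
      refine iSup_le fun g t ht => ⟨DirectSum.of (fun g => 𝒯 g) g ⟨t, ht⟩, ?_⟩
      rw [DirectSum.coeAddMonoidHom_of]
    intro t
    exact this (AddSubgroup.mem_top t)

end Internal

section Tensor

variable {G : Type*} [AddCommGroup G] [DecidableEq G]
  {R : Type*} [CommRing R] {M N : Type*} [AddCommGroup M] [AddCommGroup N] [Module R M] [Module R N]

/-- The degree `g` part of `M ⊗[R] N`: the subgroup generated by the tensors `x ⊗ y` with `x` and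
`y` homogeneous of degrees adding up to `g`. -/
def tensorDeg (ℳ : G → AddSubgroup M) (𝒩 : G → AddSubgroup N) (g : G) : AddSubgroup (M ⊗[R] N) :=
  AddSubgroup.closure {t | ∃ i j : G, i + j = g ∧ ∃ x ∈ ℳ i, ∃ y ∈ 𝒩 j, t = x ⊗ₜ[R] y}

theorem tmul_mem_tensorDeg {ℳ : G → AddSubgroup M} {𝒩 : G → AddSubgroup N} {i j : G} {x : M} {y : N}
    (hx : x ∈ ℳ i) (hy : y ∈ 𝒩 j) : x ⊗ₜ[R] y ∈ tensorDeg (R := R) ℳ 𝒩 (i + j) :=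
  AddSubgroup.subset_closure ⟨i, j, rfl, x, hx, y, hy, rfl⟩

/-- An additive map from the tensor product respects degrees once it does so on homogeneous
tensors. -/
theorem tensorDeg_map_mem {ℳ : G → AddSubgroup M} {𝒩 : G → AddSubgroup N} {P : Type*}
    [AddCommGroup P] {𝒬 : G → AddSubgroup P} (f : M ⊗[R] N →+ P)
    (d : G) (hf : ∀ i j x y, x ∈ ℳ i → y ∈ 𝒩 j → f (x ⊗ₜ[R] y) ∈ 𝒬 (d + (i + j)))
    {g : G} {t : M ⊗[R] N} (ht : t ∈ tensorDeg (R := R) ℳ 𝒩 g) : f t ∈ 𝒬 (d + g) := by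
  have : tensorDeg (R := R) ℳ 𝒩 g ≤ (𝒬 (d + g)).comap f := by
    refine (AddSubgroup.closure_le _).2 ?_
    rintro _ ⟨i, j, rfl, x, hx, y, hy, rfl⟩
    exact hf i j x y hx hy
  exact this ht

/-- Additive maps on a tensor product that agree on pure tensors are equal. -/
theorem tensor_congr {P : Type*} [AddCommGroup P] (f f' : M ⊗[R] N →+ P)
    (hf : ∀ x y, f (x ⊗ₜ[R] y) = f' (x ⊗ₜ[R] y)) (t : M ⊗[R] N) : f t = f' t := by
  induction t using TensorProduct.induction_on with
  | zero => rw [map_zero, map_zero]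
  | add a b ha hb => rw [map_add, map_add, ha, hb]
  | tmul a b => exact hf a b

/-- An additive map on `M ⊗[R] N` is linear for an action on the first factor once it is so on pure
tensors. -/
theorem tensor_map_smul {S : Type*} [CommRing S] [Module S M] [SMulCommClass R S M]
    {P : Type*} [AddCommGroup P] [Module S P] (f : M ⊗[R] N →+ P)
    (hf : ∀ (s : S) x y, f ((s • x) ⊗ₜ[R] y) = s • f (x ⊗ₜ[R] y)) (s : S) (t : M ⊗[R] N) :
    f (s • t) = s • f t := by
  induction t using TensorProduct.induction_on with
  | zero => rw [smul_zero, map_zero, smul_zero]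
  | add a b ha hb => rw [smul_add, map_add, map_add, smul_add, ha, hb]
  | tmul a b => exact hf s a b

variable (ℳ : G → AddSubgroup M) (𝒩 : G → AddSubgroup N)
  [DirectSum.Decomposition ℳ] [DirectSum.Decomposition 𝒩]

/-- The biadditive map sending homogeneous `x`, `y` of degrees `i`, `j` to `x ⊗ y`, placed in
degree `i + j`. -/
noncomputable def tensorSplitAux : M →+ N →+ (G →₀ (M ⊗[R] N)) :=
  let inner : ∀ i j : G, ℳ i →+ 𝒩 j →+ (G →₀ (M ⊗[R] N)) := fun i j =>
    AddMonoidHom.mk' (fun x => AddMonoidHom.mk'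
      (fun y => Finsupp.single (i + j) ((x : M) ⊗ₜ[R] (y : N)))
      (fun y y' => by simp [TensorProduct.tmul_add]))
      (fun x x' => by ext y : 1; simp [TensorProduct.add_tmul])
  let F : (⨁ i, ℳ i) →+ (⨁ j, 𝒩 j) →+ (G →₀ (M ⊗[R] N)) :=
    DirectSum.toAddMonoid fun i => (DirectSum.toAddMonoid fun j => (inner i j).flip).flip
  AddMonoidHom.mk' (fun m => (F (DirectSum.decompose ℳ m)).comp
      (DirectSum.decomposeAddEquiv 𝒩).toAddMonoidHom)
    (fun m m' => by ext n : 1; simp)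

theorem tensorSplitAux_apply {i j : G} {x : M} {y : N} (hx : x ∈ ℳ i) (hy : y ∈ 𝒩 j) :
    tensorSplitAux (R := R) ℳ 𝒩 x y = Finsupp.single (i + j) (x ⊗ₜ[R] y) := by
  simp [tensorSplitAux, DirectSum.decompose_of_mem _ hx, DirectSum.decompose_of_mem _ hy]

theorem tensorSplitAux_smul (𝒜 : G → AddSubgroup R) [GradedRing 𝒜]
    [SetLike.GradedSMul 𝒜 ℳ] [SetLike.GradedSMul 𝒜 𝒩] (r : R) (m : M) (n : N) :
    tensorSplitAux (R := R) ℳ 𝒩 (r • m) n = tensorSplitAux (R := R) ℳ 𝒩 m (r • n) := by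
  induction r using DirectSum.Decomposition.inductionOn 𝒜 with
  | zero => simp
  | add r r' h h' => simp [add_smul, h, h']
  | @homogeneous d r =>
    induction m using DirectSum.Decomposition.inductionOn ℳ with
    | zero => simp
    | add m m' h h' => simp [h, h']
    | @homogeneous i m =>
      induction n using DirectSum.Decomposition.inductionOn 𝒩 with
      | zero => simp
      | add n n' h h' => simp only [map_add, smul_add, h, h']
      | @homogeneous j n =>
        have h1 : (r : R) • (m : M) ∈ ℳ (d + i) := SetLike.GradedSMul.smul_mem r.2 m.2
        have h2 : (r : R) • (n : N) ∈ 𝒩 (d + j) := SetLike.GradedSMul.smul_mem r.2 n.2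
        rw [tensorSplitAux_apply ℳ 𝒩 h1 n.2, tensorSplitAux_apply ℳ 𝒩 m.2 h2,
          TensorProduct.smul_tmul, show d + i + j = i + (d + j) by abel]

theorem tensorDeg_isInternal (𝒜 : G → AddSubgroup R) [GradedRing 𝒜]
    [SetLike.GradedSMul 𝒜 ℳ] [SetLike.GradedSMul 𝒜 𝒩] : DirectSum.IsInternal (tensorDeg (R := R) ℳ 𝒩) := by
  refine isInternal_of_map _
    (TensorProduct.liftAddHom (tensorSplitAux (R := R) ℳ 𝒩)
      (fun r m n => tensorSplitAux_smul ℳ 𝒩 𝒜 r m n)) ?_ ?_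
  · intro g t ht
    refine AddSubgroup.closure_induction ?_ ?_ ?_ ?_ ht
    · rintro _ ⟨i, j, rfl, x, hx, y, hy, rfl⟩
      exact tensorSplitAux_apply ℳ 𝒩 hx hy
    · simp
    · intro a b _ _ ha hb
      rw [map_add, ha, hb, Finsupp.single_add]
    · intro a _ ha
      rw [map_neg, ha, Finsupp.single_neg]
  · rw [eq_top_iff]
    intro t _
    induction t using TensorProduct.induction_on with
    | zero => exact zero_mem _
    | add a b ha hb => exact add_mem (ha trivial) (hb trivial)
    | tmul m n =>
      induction m using DirectSum.Decomposition.inductionOn ℳ with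
      | zero => simp
      | add m m' h h' => rw [TensorProduct.add_tmul]; exact add_mem (h trivial) (h' trivial)
      | @homogeneous i m =>
        induction n using DirectSum.Decomposition.inductionOn 𝒩 with
        | zero => simp
        | add n n' h h' => rw [TensorProduct.tmul_add]; exact add_mem (h trivial) (h' trivial)
        | @homogeneous j n =>
          exact AddSubgroup.mem_iSup_of_mem (i + j) (tmul_mem_tensorDeg m.2 n.2)

end Tensor

section Hom

variable {G : Type*} [AddCommGroup G]
  {R : Type*} [CommRing R] {M N : Type*} [AddCommGroup M] [AddCommGroup N] [Module R M] [Module R N]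
  (ℳ : G → AddSubgroup M) (𝒩 : G → AddSubgroup N)

/-- The `R`-linear maps `u : M → N` that are homogeneous of degree `g`, i.e. `u (M_i) ⊆ N_{i+g}`. -/
def homDeg (g : G) : AddSubgroup (M →ₗ[R] N) where
  carrier := {u | ∀ i x, x ∈ ℳ i → u x ∈ 𝒩 (i + g)}
  zero_mem' _ _ _ := zero_mem _
  add_mem' hu hv i x hx := add_mem (hu i x hx) (hv i x hx)
  neg_mem' hu i x hx := neg_mem (hu i x hx)

/-- The group of finite sums of homogeneous `R`-linear maps `M → N`. -/
def homSum : AddSubgroup (M →ₗ[R] N) := ⨆ g, homDeg ℳ 𝒩 g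

theorem homDeg_le_homSum (g : G) : homDeg (R := R) ℳ 𝒩 g ≤ homSum ℳ 𝒩 := le_iSup _ g

/-- The degree `g` part of `homSum`. -/
def homSumDeg (g : G) : AddSubgroup (homSum (R := R) ℳ 𝒩) :=
  (homDeg ℳ 𝒩 g).addSubgroupOf (homSum ℳ 𝒩)

variable {ℳ 𝒩} in
/-- Pre- or postcomposition style operations that shift degrees by `d` preserve `homSum`. -/
theorem homSum_map_mem {M' N' : Type*} [AddCommGroup M'] [AddCommGroup N']
    {R' : Type*} [CommRing R'] [Module R' M'] [Module R' N']
    {ℳ' : G → AddSubgroup M'} {𝒩' : G → AddSubgroup N'}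
    (f : (M →ₗ[R] N) →+ (M' →ₗ[R'] N')) (d : G)
    (hf : ∀ g u, u ∈ homDeg ℳ 𝒩 g → f u ∈ homDeg ℳ' 𝒩' (d + g))
    {u : M →ₗ[R] N} (hu : u ∈ homSum ℳ 𝒩) : f u ∈ homSum ℳ' 𝒩' := by
  have : homSum ℳ 𝒩 ≤ (homSum ℳ' 𝒩').comap f :=
    iSup_le fun g u hu => homDeg_le_homSum ℳ' 𝒩' _ (hf g u hu)
  exact this hu

theorem homSumDeg_isInternal [DecidableEq G] [DirectSum.Decomposition ℳ]
    [DirectSum.Decomposition 𝒩] :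
    DirectSum.IsInternal (homSumDeg (R := R) ℳ 𝒩) := by
  constructor
  · rw [injective_iff_map_eq_zero]
    intro x hx
    have key : ∀ (x : ⨁ g, homSumDeg (R := R) ℳ 𝒩 g) (i : G) (m : M) (_ : m ∈ ℳ i) (g : G),
        (DirectSum.decompose 𝒩
          (((DirectSum.coeAddMonoidHom (homSumDeg (R := R) ℳ 𝒩) x : homSum ℳ 𝒩) :
            M →ₗ[R] N) m) (i + g) : N) = ((x g : homSum (R := R) ℳ 𝒩) : M →ₗ[R] N) m := by
      intro x i m hm g
      induction x using DirectSum.induction_on with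
      | zero => simp
      | of j a =>
        rw [DirectSum.coeAddMonoidHom_of]
        have ha : ((a : homSum (R := R) ℳ 𝒩) : M →ₗ[R] N) m ∈ 𝒩 (i + j) := a.2 i m hm
        by_cases hj : j = g
        · subst hj
          rw [DirectSum.decompose_of_mem_same _ ha, DirectSum.of_eq_same]
        · rw [DirectSum.decompose_of_mem_ne _ ha (by simpa using hj),
            DirectSum.of_eq_of_ne _ _ _ (Ne.symm hj)]
          simp
      | add x y h h' => simp [h, h']
    ext g m
    induction m using DirectSum.Decomposition.inductionOn ℳ with
    | zero => simp
    | add m m' h h' => rw [map_add, map_add, h, h']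
    | @homogeneous i m =>
      rw [← key x i m m.2 g, hx]; simp
  · rintro ⟨u, hu⟩
    have : ∀ u ∈ homSum (R := R) ℳ 𝒩, ∃ x : ⨁ g, homSumDeg (R := R) ℳ 𝒩 g,
        ((DirectSum.coeAddMonoidHom (homSumDeg (R := R) ℳ 𝒩) x : homSum ℳ 𝒩) :
            M →ₗ[R] N) = u := by
      intro u hu
      refine AddSubgroup.iSup_induction (homDeg (R := R) ℳ 𝒩)
        (C := fun u => ∃ x : ⨁ g, homSumDeg (R := R) ℳ 𝒩 g,
          ((DirectSum.coeAddMonoidHom (homSumDeg (R := R) ℳ 𝒩) x : homSum ℳ 𝒩) :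
            M →ₗ[R] N) = u) hu ?_ ⟨0, by simp⟩ ?_
      · intro g u hu
        refine ⟨DirectSum.of (fun g => homSumDeg (R := R) ℳ 𝒩 g) g
          ⟨⟨u, homDeg_le_homSum ℳ 𝒩 g hu⟩, hu⟩, ?_⟩
        rw [DirectSum.coeAddMonoidHom_of]
      · rintro _ _ ⟨x, rfl⟩ ⟨y, rfl⟩
        exact ⟨x + y, by simp⟩
    obtain ⟨x, hx⟩ := this u hu
    exact ⟨x, Subtype.ext hx⟩

/-- If a `G`-graded ring `S` acts `R`-linearly and gradedly on `M`, then `s` acts on maps out of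
`M` by `u ↦ u ∘ (s • ·)`, as a group homomorphism. -/
def precompSMul {S : Type*} [CommRing S] [Module S M] [SMulCommClass S R M] (s : S) :
    (M →ₗ[R] N) →+ (M →ₗ[R] N) where
  toFun u := u ∘ₗ Module.toModuleEnd R M s
  map_zero' := by ext; simp
  map_add' u v := by ext; simp

variable {ℳ 𝒩} in
theorem precompSMul_mem_homDeg {S : Type*} [CommRing S] [Module S M] [SMulCommClass S R M]
    {ℬ : G → AddSubgroup S} [SetLike.GradedSMul ℬ ℳ] {d g : G} {s : S} (hs : s ∈ ℬ d)
    {u : M →ₗ[R] N} (hu : u ∈ homDeg ℳ 𝒩 g) : precompSMul s u ∈ homDeg ℳ 𝒩 (d + g) := by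
  intro i x hx
  have h1 : s • x ∈ ℳ (d + i) := SetLike.GradedSMul.smul_mem hs hx
  have := hu _ _ h1
  rwa [show d + i + g = i + (d + g) by abel] at this

variable {ℳ 𝒩} in
theorem precompSMul_mem_homSum [DecidableEq G] {S : Type*} [CommRing S] [Module S M]
    [SMulCommClass S R M] (ℬ : G → AddSubgroup S) [GradedRing ℬ] [SetLike.GradedSMul ℬ ℳ] (s : S)
    {u : M →ₗ[R] N} (hu : u ∈ homSum ℳ 𝒩) : precompSMul s u ∈ homSum ℳ 𝒩 := by
  induction s using DirectSum.Decomposition.inductionOn ℬ with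
  | zero =>
    have : precompSMul (0 : S) u = 0 := by ext; simp [precompSMul]
    rw [this]; exact zero_mem _
  | add s s' h h' =>
    have : precompSMul (s + s') u = precompSMul s u + precompSMul s' u := by
      ext; simp [precompSMul, add_smul]
    rw [this]; exact add_mem h h'
  | @homogeneous d s =>
    exact homSum_map_mem (precompSMul (s : S)) d
      (fun g u hu => precompSMul_mem_homDeg (ℬ := ℬ) s.2 hu) hu

theorem smul_eq_precompSMul (r : R) (u : M →ₗ[R] N) : r • u = precompSMul r u := by
  ext x; simp [precompSMul]

end Hom

end GradedChange

open GradedChange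

/-! ### The categories of graded rings and of graded modules -/

/-- A commutative ring graded by the commutative group `G`. -/
structure GrRing (G : Type v) [AddCommGroup G] [DecidableEq G] where
  carrier : Type u
  [commRing : CommRing carrier]
  deg : G → AddSubgroup carrier
  [graded : GradedRing deg]

namespace GrRing

variable {G : Type v} [AddCommGroup G] [DecidableEq G]

instance : CoeSort (GrRing.{v, u} G) (Type u) := ⟨carrier⟩

attribute [instance] commRing graded

/-- Morphisms of `G`-graded rings: ring homomorphisms preserving degrees. -/
@[ext]
structure Hom (R S : GrRing.{v, u} G) where
  toGr : GradedRingHom R.deg S.deg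

instance : Category (GrRing.{v, u} G) where
  Hom := Hom
  id R := ⟨GradedRingHom.id R.deg⟩
  comp f g := ⟨g.toGr.comp f.toGr⟩

end GrRing

/-- A `G`-graded module over the `G`-graded ring `R`. -/
structure GrMod {G : Type v} [AddCommGroup G] [DecidableEq G] (R : GrRing.{v, u} G) where
  carrier : Type u
  [addCommGroup : AddCommGroup carrier]
  [module : Module R carrier]
  deg : G → AddSubgroup carrier
  [decomposition : DirectSum.Decomposition deg]
  [gradedSMul : SetLike.GradedSMul R.deg deg]

namespace GrMod

variable {G : Type v} [AddCommGroup G] [DecidableEq G]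

section Category

variable {R : GrRing.{v, u} G}

instance : CoeSort (GrMod R) (Type u) := ⟨carrier⟩

attribute [instance] addCommGroup module decomposition gradedSMul

/-- Morphisms of `G`-graded `R`-modules: `R`-linear maps preserving degrees. -/
@[ext]
structure Hom (M N : GrMod R) where
  toLin : M →ₗ[R] N
  map_mem : ∀ (g : G) (x : M), x ∈ M.deg g → toLin x ∈ N.deg g

instance : Category (GrMod R) where
  Hom := Hom
  id M := ⟨LinearMap.id, fun _ _ hx => hx⟩
  comp f g := ⟨g.toLin ∘ₗ f.toLin, fun i x hx => g.map_mem i _ (f.map_mem i x hx)⟩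

theorem hom_ext {M N : GrMod R} {f g : M ⟶ N} (h : ∀ x, f.toLin x = g.toLin x) : f = g :=
  Hom.ext (LinearMap.ext h)

@[simp] theorem id_toLin (M : GrMod R) : Hom.toLin (𝟙 M) = LinearMap.id := rfl

@[simp] theorem comp_toLin {M N P : GrMod R} (f : M ⟶ N) (g : N ⟶ P) :
    Hom.toLin (f ≫ g) = g.toLin ∘ₗ f.toLin := rfl

/-- The graded ring `R` as a graded module over itself. -/
def self (R : GrRing.{v, u} G) : GrMod R where
  carrier := R
  deg := R.deg
  gradedSMul := ⟨fun _ _ _ _ hr hx => SetLike.mul_mem_graded hr hx⟩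

/-- The shift `M(g)`, with `M(g)_i = M_{i+g}`. -/
noncomputable def shift (M : GrMod R) (g : G) : GrMod R where
  carrier := M
  deg i := M.deg (i + g)
  decomposition := DirectSum.IsInternal.chooseDecomposition _ <| by
    refine isInternal_of_map _
      ((DirectSum.toAddMonoid fun i : G =>
        (Finsupp.singleAddHom (i - g)).comp (M.deg i).subtype).comp
          (DirectSum.decomposeAddEquiv M.deg).toAddMonoidHom) ?_ ?_
    · intro i t ht
      simp [DirectSum.decompose_of_mem _ ht]
    · rw [eq_top_iff]
      intro x _
      induction x using DirectSum.Decomposition.inductionOn M.deg with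
      | zero => exact zero_mem _
      | add x y hx hy => exact add_mem (hx trivial) (hy trivial)
      | @homogeneous i x =>
        refine AddSubgroup.mem_iSup_of_mem (i - g) ?_
        rw [sub_add_cancel]
        exact x.2
  gradedSMul := ⟨fun i j r x hr hx => by
    have := SetLike.GradedSMul.smul_mem (A := R.deg) (B := M.deg) hr hx
    simpa [add_assoc] using this⟩

/-- The graded tensor product over `R`. -/
noncomputable def tensorObj (M N : GrMod R) : GrMod R where
  carrier := M ⊗[R] N
  deg := tensorDeg M.deg N.deg
  decomposition := (tensorDeg_isInternal M.deg N.deg R.deg).chooseDecomposition _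
  gradedSMul := ⟨fun d g r t hr ht =>
    tensorDeg_map_mem (DistribSMul.toAddMonoidHom (M ⊗[R] N) r) d (fun i j x y hx hy => by
      have h : r • x ∈ M.deg (d + i) := SetLike.GradedSMul.smul_mem hr hx
      have := tmul_mem_tensorDeg (R := R) h hy
      rwa [add_assoc, ← TensorProduct.smul_tmul'] at this) ht⟩

theorem tensor_hom_ext {M N P : GrMod R} {f k : tensorObj M N ⟶ P}
    (hf : ∀ (x : M) (y : N), f.toLin (x ⊗ₜ[R] y : M ⊗[R] N) = k.toLin (x ⊗ₜ[R] y : M ⊗[R] N)) :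
    f = k :=
  hom_ext (tensor_congr f.toLin.toAddMonoidHom k.toLin.toAddMonoidHom hf)

/-- The graded tensor product as a bifunctor. -/
noncomputable def tensor (R : GrRing.{v, u} G) : GrMod R × GrMod R ⥤ GrMod R where
  obj P := tensorObj P.1 P.2
  map {P Q} f :=
    { toLin := TensorProduct.map f.1.toLin f.2.toLin
      map_mem := fun g t ht => by
        have := tensorDeg_map_mem (𝒬 := tensorDeg Q.1.deg Q.2.deg)
          (TensorProduct.map f.1.toLin f.2.toLin).toAddMonoidHom 0 (fun i j x y hx hy => by
            rw [zero_add]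
            exact tmul_mem_tensorDeg (f.1.map_mem i x hx) (f.2.map_mem j y hy)) ht
        rwa [zero_add] at this }
  map_id P := Hom.ext TensorProduct.map_id
  map_comp f g := Hom.ext (TensorProduct.map_comp _ _ _ _)

/-- The action `(r • u) x = r • u x` on sums of homogeneous linear maps. -/
@[reducible]
def homModule (M N : GrMod R) : Module R (homSum (R := R) M.deg N.deg) where
  smul r u := ⟨r • u.1, by
    rw [smul_eq_precompSMul]; exact precompSMul_mem_homSum R.deg r u.2⟩
  one_smul u := Subtype.ext (one_smul (R : Type u) u.1)
  mul_smul r s u := Subtype.ext (mul_smul r s u.1)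
  smul_zero r := Subtype.ext (smul_zero (A := M →ₗ[R] N) r)
  smul_add r u v := Subtype.ext (smul_add r u.1 v.1)
  add_smul r s u := Subtype.ext (add_smul r s u.1)
  zero_smul u := Subtype.ext (zero_smul (R : Type u) u.1)

/-- The graded module `HOM_R(M, N)`: its elements are the finite sums of homogeneous `R`-linear
maps `M → N`, its degree `g` part consists of the homogeneous maps of degree `g`, i.e. of the
morphisms of graded modules `M ⟶ N(g)` (see `mem_homObj_deg`), and it is the direct sum of these. -/
noncomputable def homObj (M N : GrMod R) : GrMod R where
  carrier := homSum (R := R) M.deg N.deg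
  module := homModule M N
  deg := homSumDeg M.deg N.deg
  decomposition := (homSumDeg_isInternal M.deg N.deg).chooseDecomposition _
  gradedSMul :=
    letI := homModule M N
    ⟨fun d g r u hr hu => by
      change r • u.1 ∈ homDeg M.deg N.deg (d + g)
      rw [smul_eq_precompSMul]
      exact precompSMul_mem_homDeg (ℬ := R.deg) hr hu⟩

theorem mem_homObj_deg (M N : GrMod R) (g : G) (u : homObj M N) :
    u ∈ (homObj M N).deg g ↔ ∃ f : M ⟶ N.shift g, ∀ x : M, f.toLin x = u.1 x :=
  ⟨fun h => ⟨⟨u.1, h⟩, fun _ => rfl⟩, fun ⟨f, hf⟩ i x hx => hf x ▸ f.map_mem i x hx⟩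

/-- Composition with morphisms on both sides, on sums of homogeneous linear maps. -/
def compHom {M M' N N' : GrMod R} (f : M' ⟶ M) (k : N ⟶ N') : (M →ₗ[R] N) →+ (M' →ₗ[R] N') where
  toFun u := k.toLin ∘ₗ u ∘ₗ f.toLin
  map_zero' := by ext; simp
  map_add' u w := by ext; simp

theorem compHom_mem {M M' N N' : GrMod R} (f : M' ⟶ M) (k : N ⟶ N') {g : G} {u : M →ₗ[R] N}
    (hu : u ∈ homDeg M.deg N.deg g) : compHom f k u ∈ homDeg M'.deg N'.deg g :=
  fun i x hx => k.map_mem _ _ (hu i _ (f.map_mem i x hx))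

theorem compHom_mem_homSum {M M' N N' : GrMod R} (f : M' ⟶ M) (k : N ⟶ N') {u : M →ₗ[R] N}
    (hu : u ∈ homSum M.deg N.deg) : compHom f k u ∈ homSum M'.deg N'.deg :=
  homSum_map_mem (compHom f k) 0 (fun g u hu => by rw [zero_add]; exact compHom_mem f k hu) hu

/-- The graded `HOM` as a bifunctor. -/
noncomputable def hom (R : GrRing.{v, u} G) : (GrMod R)ᵒᵖ × GrMod R ⥤ GrMod R where
  obj P := homObj P.1.unop P.2
  map {P Q} f :=
    { toLin :=
        { toFun := fun u => ⟨compHom f.1.unop f.2 u.1, compHom_mem_homSum f.1.unop f.2 u.2⟩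
          map_add' := fun u w => Subtype.ext (map_add (compHom f.1.unop f.2) u.1 w.1)
          map_smul' := fun r u => Subtype.ext (LinearMap.ext fun x =>
            f.2.toLin.map_smul r (u.1 (f.1.unop.toLin x))) }
      map_mem := fun _ _ hu => compHom_mem f.1.unop f.2 hu }
  map_id _ := rfl
  map_comp _ _ := rfl

end Category

/-! ### Scalar restriction, extension and coextension along a morphism of graded rings -/

section ChangeOfRings

variable {R S : GrRing.{v, u} G} (h : R ⟶ S)

/-- The graded `S`-module `M` as a graded `R`-module, with `r • x = h r • x`. -/
def restrictObj (M : GrMod S) : GrMod R where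
  carrier := M
  module := Module.compHom M (h.toGr : R →+* S)
  deg := M.deg
  gradedSMul :=
    letI := Module.compHom M (h.toGr : R →+* S)
    ⟨fun _ _ r x hr hx => by
      have hr' : h.toGr r ∈ S.deg _ := h.toGr.map_mem hr
      exact M.gradedSMul.smul_mem hr' hx⟩

/-- Scalar restriction `h_*`. -/
def restrictScalars : GrMod S ⥤ GrMod R where
  obj := restrictObj h
  map {M N} f :=
    { toLin :=
        { toFun := f.toLin
          map_add' := f.toLin.map_add
          map_smul' := fun r x => f.toLin.map_smul (h.toGr r) x }
      map_mem := f.map_mem }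
  map_id _ := rfl
  map_comp _ _ := rfl

/-- The original `S`-action on `h_*(M)`. -/
instance restrictModule (M : GrMod S) : Module S (restrictObj h M) :=
  inferInstanceAs (Module S M)

theorem restrict_smul (M : GrMod S) (r : R) (x : restrictObj h M) : r • x = h.toGr r • x := rfl

instance restrictSMulComm (M : GrMod S) : SMulCommClass S R (restrictObj h M) :=
  ⟨fun s r x => by rw [restrict_smul, restrict_smul, ← mul_smul, ← mul_smul, mul_comm]⟩

instance restrictSMulCommSymm (M : GrMod S) : SMulCommClass R S (restrictObj h M) :=
  SMulCommClass.symm _ _ _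

instance restrictGradedSMul (M : GrMod S) : SetLike.GradedSMul S.deg (restrictObj h M).deg :=
  M.gradedSMul

/-- The graded `S`-module `S ⊗_R N`: the graded tensor product `h_*(S) ⊗_R N`, with
`s • (t ⊗ y) = (s * t) ⊗ y`. -/
noncomputable def extendObj (N : GrMod R) : GrMod S where
  carrier := restrictObj h (self S) ⊗[R] N
  module := TensorProduct.leftModule
  deg := tensorDeg (restrictObj h (self S)).deg N.deg
  decomposition := (tensorObj (restrictObj h (self S)) N).decomposition
  gradedSMul := ⟨fun d g s t hs ht =>
    tensorDeg_map_mem (DistribSMul.toAddMonoidHom (restrictObj h (self S) ⊗[R] N) s) d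
      (fun i j x y hx hy => by
        have hsx : s • x ∈ (restrictObj h (self S)).deg (d + i) :=
          SetLike.GradedSMul.smul_mem (A := S.deg) hs hx
        have := tmul_mem_tensorDeg (R := R) hsx hy
        rwa [add_assoc, ← TensorProduct.smul_tmul'] at this) ht⟩

theorem extend_hom_ext {N : GrMod R} {P : GrMod S} {f k : extendObj h N ⟶ P}
    (hf : ∀ (s : restrictObj h (self S)) (x : N),
      f.toLin (s ⊗ₜ[R] x : restrictObj h (self S) ⊗[R] N) =
      k.toLin (s ⊗ₜ[R] x : restrictObj h (self S) ⊗[R] N)) : f = k :=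
  hom_ext (tensor_congr (M := restrictObj h (self S)) f.toLin.toAddMonoidHom
    k.toLin.toAddMonoidHom hf)

/-- Scalar extension `h^* = S ⊗_R •`. -/
noncomputable def extendScalars : GrMod R ⥤ GrMod S where
  obj := extendObj h
  map {M N} f :=
    { toLin :=
        { toFun := TensorProduct.map LinearMap.id f.toLin
          map_add' := map_add _
          map_smul' := tensor_map_smul (M := restrictObj h (self S))
            (P := restrictObj h (self S) ⊗[R] N)
            (TensorProduct.map LinearMap.id f.toLin).toAddMonoidHom (fun _ _ _ => rfl) }
      map_mem := ((tensor R).map (X := (restrictObj h (self S), M))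
        (Y := (restrictObj h (self S), N)) (𝟙 _, f)).map_mem }
  map_id N := hom_ext fun t => LinearMap.congr_fun
    (TensorProduct.map_id (R := R) (M := restrictObj h (self S)) (N := N)) t
  map_comp _ _ := extend_hom_ext h fun _ _ => rfl

/-- The action `(s • u) x = u (s * x)` on sums of homogeneous `R`-linear maps from `S`. -/
@[reducible]
def coextendModule (N : GrMod R) :
    Module S (homSum (R := R) (restrictObj h (self S)).deg N.deg) where
  smul s u := ⟨precompSMul s u.1, precompSMul_mem_homSum S.deg s u.2⟩
  one_smul u := Subtype.ext (LinearMap.ext fun x => congrArg u.1 (one_smul S x))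
  mul_smul r s u := Subtype.ext (LinearMap.ext fun x => congrArg u.1
    ((congrArg (fun a : S => a • x) (mul_comm r s)).trans (mul_smul s r x)))
  smul_zero r := Subtype.ext (map_zero (precompSMul r))
  smul_add r u v := Subtype.ext (map_add (precompSMul r) u.1 v.1)
  add_smul r s u := Subtype.ext (LinearMap.ext fun x =>
    (congrArg u.1 (add_smul r s x)).trans (map_add u.1 _ _))
  zero_smul u := Subtype.ext (LinearMap.ext fun x =>
    show u.1 ((0 : S) • x) = 0 from (congrArg u.1 (zero_smul S x)).trans (map_zero u.1))

/-- The graded `S`-module `HOM_R(S, N)`: the graded module `HOM_R(h_*(S), N)`, with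
`(s • u) x = u (s * x)`. -/
noncomputable def coextendObj (N : GrMod R) : GrMod S where
  carrier := homSum (R := R) (restrictObj h (self S)).deg N.deg
  module := coextendModule h N
  deg := homSumDeg (restrictObj h (self S)).deg N.deg
  decomposition :=
    (homSumDeg_isInternal (restrictObj h (self S)).deg N.deg).chooseDecomposition _
  gradedSMul :=
    letI := coextendModule h N
    ⟨fun d g s u hs hu => precompSMul_mem_homDeg (ℬ := S.deg) hs hu⟩

/-- Scalar coextension `h~ = HOM_R(S, •)`. -/
noncomputable def coextendScalars : GrMod R ⥤ GrMod S where
  obj := coextendObj h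
  map {M N} f :=
    { toLin :=
        { toFun := fun u => ⟨compHom (𝟙 (restrictObj h (self S))) f u.1,
            compHom_mem_homSum (𝟙 (restrictObj h (self S))) f u.2⟩
          map_add' := fun u w => Subtype.ext
            (map_add (compHom (𝟙 (restrictObj h (self S))) f) u.1 w.1)
          map_smul' := fun s u => rfl }
      map_mem := fun _ _ hu => compHom_mem (𝟙 (restrictObj h (self S))) f hu }
  map_id _ := rfl
  map_comp _ _ := rfl

/-! ### The two adjunctions -/

/-- `x ↦ 1 ⊗ x`, from `M` to `h_*(h^*(M))`. -/
noncomputable def rho : 𝟭 (GrMod R) ⟶ extendScalars h ⋙ restrictScalars h where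
  app M :=
    { toLin :=
        { toFun := fun x => (show restrictObj h (self S) from (1 : S)) ⊗ₜ[R] x
          map_add' := fun x y => TensorProduct.tmul_add _ x y
          map_smul' := fun r x => (TensorProduct.smul_tmul r _ x).symm }
      map_mem := fun g x hx => by
        have h1 : (1 : S) ∈ (restrictObj h (self S)).deg 0 := SetLike.one_mem_graded S.deg
        have := tmul_mem_tensorDeg (R := R) (M := restrictObj h (self S)) h1 hx
        rwa [zero_add] at this }
  naturality _ _ _ := rfl

/-- The action of `S` on the graded `S`-module `N`, as a function. -/
def act (N : GrMod S) (s : S) (x : N) : N := s • x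

/-- The `R`-bilinear map `(s, x) ↦ s • x` from `S × N` to `N`. -/
def actBilin (N : GrMod S) :
    restrictObj h (self S) →ₗ[R] restrictObj h N →ₗ[R] restrictObj h N :=
  LinearMap.mk₂ R (M := restrictObj h (self S)) (Nₗ := restrictObj h N) (Pₗ := restrictObj h N)
    (fun s x => act N s x) (fun s s' x => add_smul (R := S) (M := N) s s' x)
    (fun r s x => mul_smul (α := S) (β := N) (h.toGr r) s x)
    (fun s x x' => smul_add (M := S) (A := N) s x x')
    (fun r s x => smul_comm (M := S) (N := S) (α := N) s (h.toGr r) x)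

theorem actBilin_apply (N : GrMod S) (s : S) (x : N) : actBilin h N s x = act N s x := rfl

/-- `s ⊗ x ↦ s • x`, from `h^*(h_*(N))` to `N`. -/
noncomputable def sigma : restrictScalars h ⋙ extendScalars h ⟶ 𝟭 (GrMod S) where
  app N :=
    { toLin :=
        { toFun := TensorProduct.lift (actBilin h N)
          map_add' := map_add _
          map_smul' := tensor_map_smul (M := restrictObj h (self S)) (N := restrictObj h N)
            (P := N) (TensorProduct.lift (actBilin h N)).toAddMonoidHom
            (fun s a b => mul_smul (α := S) (β := N) s a b) }
      map_mem := fun g t ht => by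
        have := tensorDeg_map_mem (𝒬 := N.deg)
          (TensorProduct.lift (actBilin h N)).toAddMonoidHom 0 (fun i j s x hs hx => by
            rw [zero_add]
            exact N.gradedSMul.smul_mem hs hx) ht
        rwa [zero_add] at this }
  naturality M N f := extend_hom_ext h fun (a : S) (b : M) => (f.toLin.map_smul a b).symm

/-- The adjunction `(h^*, h_*)`, with unit `rho h` and counit `sigma h`. -/
noncomputable def extendRestrictAdj : extendScalars h ⊣ restrictScalars h :=
  Adjunction.mkOfUnitCounit
    { unit := rho h
      counit := sigma h
      left_triangle := by
        ext M
        exact extend_hom_ext h fun (a : S) (b : M) =>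
          congrArg (fun s : restrictObj h (self S) => s ⊗ₜ[R] b) (mul_one (M := S) a)
      right_triangle := by
        ext N
        exact hom_ext fun x => one_smul S (show N from x) }

theorem act_act_comm (N : GrMod S) (s t : S) (x : N) :
    act N t (act N s x) = act N (act (self S) s t) x :=
  (mul_smul t s x).symm.trans (congrArg (fun a : S => a • x) (mul_comm t s))

theorem actBilin_flip_mem_homDeg (N : GrMod S) {g : G} {x : N} (hx : x ∈ N.deg g) :
    (actBilin h N).flip x ∈ homDeg (restrictObj h (self S)).deg (restrictObj h N).deg g :=
  fun _ _ hs => N.gradedSMul.smul_mem hs hx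

theorem actBilin_flip_mem_homSum (N : GrMod S) (x : restrictObj h N) :
    (actBilin h N).flip x ∈ homSum (restrictObj h (self S)).deg (restrictObj h N).deg := by
  induction x using DirectSum.Decomposition.inductionOn (restrictObj h N).deg with
  | zero => rw [map_zero]; exact zero_mem _
  | add x y hx hy => rw [map_add]; exact add_mem hx hy
  | @homogeneous g x => exact homDeg_le_homSum _ _ g (actBilin_flip_mem_homDeg h N x.2)

/-- `x ↦ (s ↦ s • x)`, from `N` to `HOM_R(S, h_*(N))`. -/
noncomputable def rhoTilde : 𝟭 (GrMod S) ⟶ restrictScalars h ⋙ coextendScalars h where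
  app N :=
    { toLin :=
        { toFun := fun x => ⟨(actBilin h N).flip x, actBilin_flip_mem_homSum h N x⟩
          map_add' := fun x y => Subtype.ext (map_add (actBilin h N).flip x y)
          map_smul' := fun s x => Subtype.ext (LinearMap.ext fun t =>
            act_act_comm N s t x) }
      map_mem := fun _ _ hx => actBilin_flip_mem_homDeg h N hx }
  naturality M N f := hom_ext fun x => Subtype.ext (LinearMap.ext fun s =>
    (f.toLin.map_smul s x).symm)

/-- `u ↦ u 1`, from `HOM_R(S, M)` to `M`. -/
noncomputable def sigmaTilde : coextendScalars h ⋙ restrictScalars h ⟶ 𝟭 (GrMod R) where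
  app M :=
    { toLin :=
        { toFun := fun u => u.1 (1 : S)
          map_add' := fun _ _ => rfl
          map_smul' := fun r u => u.1.map_smul r (1 : S) }
      map_mem := fun g u hu => by
        have h1 : (1 : S) ∈ (restrictObj h (self S)).deg 0 := SetLike.one_mem_graded S.deg
        have := hu 0 (1 : S) h1
        rwa [zero_add] at this }
  naturality _ _ _ := rfl

/-- The adjunction `(h_*, h~)`, with unit `rhoTilde h` and counit `sigmaTilde h`. -/
noncomputable def restrictCoextendAdj : restrictScalars h ⊣ coextendScalars h :=
  Adjunction.mkOfUnitCounit
    { unit := rhoTilde h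
      counit := sigmaTilde h
      left_triangle := by
        ext N
        exact hom_ext fun x => one_smul S (show N from x)
      right_triangle := by
        ext M
        exact hom_ext fun u => Subtype.ext (LinearMap.ext fun s =>
          congrArg u.1 (mul_one (M := S) s)) }

/-! ### Comparison of tensor products and of graded modules of homomorphisms -/

/-- The pure tensor `x ⊗ y`, as an element of the graded module `M ⊗_S N`. -/
def pureTensor (M N : GrMod S) (x : M) (y : N) : tensorObj M N := (x ⊗ₜ[S] y : M ⊗[S] N)

/-- The `R`-bilinear map `(x, y) ↦ x ⊗ y` from `M × N` to `M ⊗_S N`. -/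
noncomputable def gammaBilin (M N : GrMod S) :
    restrictObj h M →ₗ[R] restrictObj h N →ₗ[R] restrictObj h (tensorObj M N) :=
  LinearMap.mk₂ R (M := restrictObj h M) (Nₗ := restrictObj h N)
    (Pₗ := restrictObj h (tensorObj M N)) (fun x y => pureTensor M N x y)
    (fun x x' y => TensorProduct.add_tmul (R := S) (M := M) (N := N) x x' y) (fun _ _ _ => rfl)
    (fun x y y' => TensorProduct.tmul_add (R := S) (M := M) (N := N) x y y')
    (fun r x y => TensorProduct.tmul_smul (R := S) (M := M) (N := N) (h.toGr r) x y)

/-- `x ⊗ y ↦ x ⊗ y`, from `h_*(M) ⊗_R h_*(N)` to `h_*(M ⊗_S N)`. -/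
noncomputable def gamma :
    (restrictScalars h).prod (restrictScalars h) ⋙ tensor R ⟶ tensor S ⋙ restrictScalars h where
  app P :=
    { toLin := TensorProduct.lift (gammaBilin h P.1 P.2)
      map_mem := fun g t ht => by
        have := tensorDeg_map_mem (𝒬 := tensorDeg P.1.deg P.2.deg)
          (TensorProduct.lift (gammaBilin h P.1 P.2)).toAddMonoidHom 0 (fun i j x y hx hy => by
            rw [zero_add]
            exact tmul_mem_tensorDeg (R := S) (ℳ := P.1.deg) (𝒩 := P.2.deg) hx hy) ht
        rwa [zero_add] at this }
  naturality _ _ _ := tensor_hom_ext fun _ _ => rfl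

/-- An `S`-linear map regarded as an `R`-linear map. -/
def restrictLin (M N : GrMod S) : (M →ₗ[S] N) →+ (restrictObj h M →ₗ[R] restrictObj h N) where
  toFun u :=
    { toFun := u
      map_add' := u.map_add
      map_smul' := fun r x => u.map_smul (h.toGr r) x }
  map_zero' := rfl
  map_add' _ _ := rfl

theorem restrictLin_mem_homSum (M N : GrMod S) {u : M →ₗ[S] N} (hu : u ∈ homSum M.deg N.deg) :
    restrictLin h M N u ∈ homSum (restrictObj h M).deg (restrictObj h N).deg :=
  homSum_map_mem (restrictLin h M N) 0 (fun g u hu => by rw [zero_add]; exact hu) hu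

/-- `u ↦ u`, from `h_*(HOM_S(M, N))` to `HOM_R(h_*(M), h_*(N))`. -/
noncomputable def eta :
    hom S ⋙ restrictScalars h ⟶ (restrictScalars h).op.prod (restrictScalars h) ⋙ hom R where
  app P :=
    { toLin :=
        { toFun := fun u => ⟨restrictLin h P.1.unop P.2 u.1,
            restrictLin_mem_homSum h P.1.unop P.2 u.2⟩
          map_add' := fun _ _ => rfl
          map_smul' := fun _ _ => rfl }
      map_mem := fun _ _ hu => hu }
  naturality _ _ _ := rfl

/-- The natural transformation `eta h` with its first argument fixed to be `M`. -/
noncomputable def etaLeft (M : GrMod S) :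
    Prod.sectR (op M) (GrMod S) ⋙ hom S ⋙ restrictScalars h ⟶
      Prod.sectR (op M) (GrMod S) ⋙ (restrictScalars h).op.prod (restrictScalars h) ⋙ hom R :=
  Functor.whiskerLeft (Prod.sectR (op M) (GrMod S)) (eta h)

end ChangeOfRings

end GrMod

/-!
Each of the seven conditions is equivalent to the single identity `1 ⊗ s = s ⊗ 1` in `S ⊗_R S`, for
all `s : S` (`GrMod.OneTmulEqTmulOne`).

Given this identity, every `R`-bilinear map `B` on `S × S` satisfies `B 1 s = B s 1`
(`GrMod.OneTmulEqTmulOne.bilin`). Suitable choices of `B` show that tensor products of `S`-modules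
over `R` are already balanced over `S` (`GrMod.OneTmulEqTmulOne.tmul_act`), that `R`-linear maps
between `S`-modules are `S`-linear (`GrMod.OneTmulEqTmulOne.map_act`), and that two morphisms of
graded rings out of `S` that agree on `R` are equal. This makes `h` an epimorphism and `σ`, `γ`,
`η` bijective in each component, and a bijective morphism of graded modules is an isomorphism
(`GrMod.isIso_iff_bijective`).

Conversely, the identity is recovered from an epimorphism by means of the two graded ring morphisms
`S → S ⊗_R S`; from `σ_S` or `γ_{S,S}` because `1 ⊗ s` and `s ⊗ 1` have the same image; and from
`η_{S,•}` because it makes the `R`-linear map `S → S ⊗_R S`, `s ↦ 1 ⊗ s`, linear over `S` for the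
action on the first factor. Finally, the counit of `h^* ⊣ h_*` and the unit of `h_* ⊣ h~` are
isomorphisms if and only if `h_*` is fully faithful, hence simultaneously.
-/

namespace GrMod

variable {G : Type v} [AddCommGroup G] [DecidableEq G]

/-! ### Isomorphisms of graded modules -/

section Iso

variable {R : GrRing.{v, u} G} {M N : GrMod R}

/-- A degree-preserving injective map reflects degrees, because it maps the homogeneous components
of an element to the homogeneous components of its image. -/
theorem mem_deg_of_toLin_mem (f : M ⟶ N) (hf : Function.Injective f.toLin) {g : G} {x : M}
    (hx : f.toLin x ∈ N.deg g) : x ∈ M.deg g := by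
  have key : ∀ (y : M) (i : G), f.toLin (DirectSum.decompose M.deg y i) =
      DirectSum.decompose N.deg (f.toLin y) i := by
    intro y i
    induction y using DirectSum.Decomposition.inductionOn M.deg with
    | zero => simp
    | add y z hy hz => simp [hy, hz]
    | @homogeneous j y =>
      by_cases hj : j = i
      · subst hj
        rw [DirectSum.decompose_of_mem_same _ y.2,
          DirectSum.decompose_of_mem_same _ (f.map_mem _ _ y.2)]
      · rw [DirectSum.decompose_of_mem_ne _ y.2 hj,
          DirectSum.decompose_of_mem_ne _ (f.map_mem _ _ y.2) hj, map_zero]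
  have hxg : (DirectSum.decompose M.deg x g : M) = x :=
    hf ((key x g).trans (DirectSum.decompose_of_mem_same _ hx))
  exact hxg ▸ (DirectSum.decompose M.deg x g).2

theorem isIso_iff_bijective (f : M ⟶ N) : IsIso f ↔ Function.Bijective f.toLin := by
  constructor
  · intro _
    refine Function.bijective_iff_has_inverse.2 ⟨(inv f).toLin, fun x => ?_, fun x => ?_⟩
    · exact LinearMap.congr_fun (congrArg Hom.toLin (IsIso.hom_inv_id f)) x
    · exact LinearMap.congr_fun (congrArg Hom.toLin (IsIso.inv_hom_id f)) x
  · intro hf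
    let e := LinearEquiv.ofBijective f.toLin hf
    have he : ∀ y, f.toLin (e.symm y) = y := e.apply_symm_apply
    refine ⟨⟨⟨e.symm.toLinearMap, fun g y hy => ?_⟩, ?_, ?_⟩⟩
    · refine mem_deg_of_toLin_mem f hf.1 ?_
      change f.toLin (e.symm y) ∈ _
      rwa [he]
    · exact hom_ext e.symm_apply_apply
    · exact hom_ext he

end Iso

section ChangeOfRings

variable {R S : GrRing.{v, u} G} (h : R ⟶ S)

/-! ### Equality of the two inclusions into the tensor square -/

/-- The two inclusions `s ↦ 1 ⊗ s` and `s ↦ s ⊗ 1` of `S` into `S ⊗_R S` agree. -/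
def OneTmulEqTmulOne : Prop :=
  ∀ s : restrictObj h (self S),
    (show restrictObj h (self S) from (1 : S)) ⊗ₜ[R] s =
      s ⊗ₜ[R] (show restrictObj h (self S) from (1 : S))

variable {h}

/-- Every `R`-bilinear map on `S × S` inherits the symmetry of `OneTmulEqTmulOne`. -/
theorem OneTmulEqTmulOne.bilin (H : OneTmulEqTmulOne h) {P : Type*} [AddCommGroup P] [Module R P]
    (B : restrictObj h (self S) →ₗ[R] restrictObj h (self S) →ₗ[R] P) (s : S) :
    B (1 : S) s = B s (1 : S) :=
  congrArg (TensorProduct.lift B) (H s)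

/-- The action of `S` on a fixed element of a graded `S`-module, as an `R`-linear map. -/
def actOn (N : GrMod S) (x : N) : restrictObj h (self S) →ₗ[R] restrictObj h N :=
  (actBilin h N).flip x

theorem actOn_one (N : GrMod S) (x : N) : actOn (h := h) N x (1 : S) = x := one_smul S x

/-- Tensor products over `R` are balanced over `S`: compare the values at `(1, s)` and `(s, 1)` of
the `R`-bilinear map `(a, b) ↦ (a • x) ⊗ (b • y)`. -/
theorem OneTmulEqTmulOne.tmul_act (H : OneTmulEqTmulOne h) (M N : GrMod S) (s : S) (x : M)
    (y : N) :
    (show restrictObj h M from x) ⊗ₜ[R] (show restrictObj h N from act N s y) =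
      (show restrictObj h M from act M s x) ⊗ₜ[R] (show restrictObj h N from y) := by
  have := H.bilin ((TensorProduct.mk R (restrictObj h M) (restrictObj h N)).compl₁₂
    (actOn M x) (actOn N y)) s
  have h1 : (actOn (h := h) M x (1 : S)) ⊗ₜ[R] (actOn (h := h) N y s) =
    (actOn (h := h) M x s) ⊗ₜ[R] (actOn (h := h) N y (1 : S)) := this
  rwa [actOn_one, actOn_one] at h1

/-- `R`-linear maps between `S`-modules are `S`-linear: compare the values at `(1, s)` and `(s, 1)`
of the `R`-bilinear map `(a, b) ↦ a • u (b • x)`. -/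
theorem OneTmulEqTmulOne.map_act (H : OneTmulEqTmulOne h) {M N : GrMod S}
    (u : restrictObj h M →ₗ[R] restrictObj h N) (s : S) (x : M) :
    u (act M s x) = act N s (u x) := by
  have := H.bilin ((actBilin h N).compl₁₂ LinearMap.id (u ∘ₗ actOn M x)) s
  have h1 : act N (1 : S) (u (actOn (h := h) M x s)) =
    act N s (u (actOn (h := h) M x (1 : S))) := this
  rw [actOn_one] at h1
  exact (one_smul S (show N from u (act M s x))).symm.trans h1

/-! ### Epimorphisms of graded rings -/

section TensorSquare

variable (h)

/-- The `G`-graded ring `S ⊗_R S`. -/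
noncomputable def tensorSquare : GrRing.{v, u} G :=
  letI : Algebra R S := (h.toGr : R →+* S).toAlgebra
  haveI : SetLike.GradedSMul R.deg S.deg := (restrictObj h (self S)).gradedSMul
  { carrier := S ⊗[R] S
    deg := tensorDeg (R := R) S.deg S.deg
    graded :=
      { (tensorDeg_isInternal S.deg S.deg R.deg).chooseDecomposition with
        one_mem := by
          have := tmul_mem_tensorDeg (R := R) (SetLike.one_mem_graded S.deg)
            (SetLike.one_mem_graded S.deg)
          rwa [zero_add] at this
        mul_mem := by
          intro i j a b ha hb
          refine tensorDeg_map_mem (AddMonoidHom.mulLeft a) i (fun k l x y hx hy => ?_) hb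
          rw [add_comm]
          refine tensorDeg_map_mem (AddMonoidHom.mulRight (x ⊗ₜ[R] y)) (k + l)
            (fun k' l' x' y' hx' hy' => ?_) ha
          have := tmul_mem_tensorDeg (R := R) (SetLike.mul_mem_graded hx' hx)
            (SetLike.mul_mem_graded hy' hy)
          rw [show k' + k + (l' + l) = k + l + (k' + l') by abel] at this
          change (x' ⊗ₜ[R] y') * (x ⊗ₜ[R] y) ∈ _
          rw [Algebra.TensorProduct.tmul_mul_tmul]
          exact this } }

/-- `s ↦ s ⊗ 1`, as a morphism of graded rings. -/
noncomputable def tensorSquareInl : S ⟶ tensorSquare h :=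
  letI : Algebra R S := (h.toGr : R →+* S).toAlgebra
  ⟨{ (Algebra.TensorProduct.includeLeftRingHom : S →+* S ⊗[R] S) with
      map_mem := fun {i x} hx => by
        have := tmul_mem_tensorDeg (R := R) hx (SetLike.one_mem_graded S.deg)
        rwa [add_zero] at this }⟩

/-- `s ↦ 1 ⊗ s`, as a morphism of graded rings. -/
noncomputable def tensorSquareInr : S ⟶ tensorSquare h :=
  letI : Algebra R S := (h.toGr : R →+* S).toAlgebra
  ⟨{ (Algebra.TensorProduct.includeRight : S →ₐ[R] S ⊗[R] S).toRingHom with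
      map_mem := fun {i x} hx => by
        have := tmul_mem_tensorDeg (R := R) (SetLike.one_mem_graded S.deg) hx
        rwa [zero_add] at this }⟩

theorem comp_tensorSquareInl : h ≫ tensorSquareInl h = h ≫ tensorSquareInr h := by
  let _ : Algebra R S := (h.toGr : R →+* S).toAlgebra
  refine GrRing.Hom.ext (GradedRingHom.ext fun r => ?_)
  exact (Algebra.TensorProduct.algebraMap_apply' (R := R) (A := S) (B := S) r)

end TensorSquare

/-- The morphisms `s ↦ s ⊗ 1` and `s ↦ 1 ⊗ s` to the graded ring `S ⊗_R S` agree after composition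
with `h`, and this pair is universal with that property. -/
theorem epi_iff_oneTmulEqTmulOne : Epi h ↔ OneTmulEqTmulOne h := by
  constructor
  · intro _ s
    have := (cancel_epi h).1 (comp_tensorSquareInl h)
    exact (DFunLike.congr_fun (congrArg GrRing.Hom.toGr this) s).symm
  · intro H
    refine ⟨fun {T} a b hab => GrRing.Hom.ext (GradedRingHom.ext fun s => ?_)⟩
    have hr : ∀ r : R, a.toGr (h.toGr r) = b.toGr (h.toGr r) :=
      DFunLike.congr_fun (congrArg GrRing.Hom.toGr hab)
    let _ : Module R T := Module.compHom T ((a.toGr : S →+* T).comp (h.toGr : R →+* S))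
    -- The symmetry applies to `(s, t) ↦ a s * b t`, which is `R`-bilinear as `a` and `b` agree
    -- on the image of `h`.
    have := H.bilin (P := T) (LinearMap.mk₂ R (M := restrictObj h (self S))
      (Nₗ := restrictObj h (self S)) (Pₗ := T) (fun s t => a.toGr s * b.toGr t)
      (fun s s' t => (congrArg (· * b.toGr t) (map_add a.toGr (s : S) (s' : S))).trans
        (add_mul _ _ _))
      (fun r s t => (congrArg (· * b.toGr t) (map_mul a.toGr (h.toGr r) (s : S))).trans
        (mul_assoc _ _ _))
      (fun s t t' => (congrArg (a.toGr s * ·) (map_add b.toGr (t : S) (t' : S))).trans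
        (mul_add _ _ _))
      (fun r s t => (congrArg (a.toGr s * ·) ((map_mul b.toGr (h.toGr r) (t : S)).trans
        (congrArg (· * b.toGr t) (hr r).symm))).trans (mul_left_comm _ _ _))) s
    have h2 : a.toGr (1 : S) * b.toGr s = a.toGr s * b.toGr (1 : S) := this
    rw [map_one, map_one, one_mul, mul_one] at h2
    exact h2.symm

/-! ### The adjunctions -/

/-- A section of `S ⊗_R N → N` is `x ↦ 1 ⊗ x`. -/
theorem sigma_app_surjective (N : GrMod S) : Function.Surjective ((sigma h).app N).toLin :=
  fun x => ⟨((rho h).app (restrictObj h N)).toLin x, one_smul S x⟩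

/-- Under `OneTmulEqTmulOne`, `s ⊗ x = 1 ⊗ s • x` in `S ⊗_R N`, so that the section `x ↦ 1 ⊗ x` of
`S ⊗_R N → N` is a two-sided inverse. -/
theorem OneTmulEqTmulOne.isIso_sigma (H : OneTmulEqTmulOne h) : IsIso (sigma h) := by
  rw [NatTrans.isIso_iff_isIso_app]
  intro N
  rw [isIso_iff_bijective]
  refine ⟨?_, sigma_app_surjective N⟩
  have key : ∀ t : restrictObj h (self S) ⊗[R] restrictObj h N,
      ((rho h).app (restrictObj h N)).toLin (((sigma h).app N).toLin t) = t := by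
    intro t
    refine tensor_congr (M := restrictObj h (self S)) (N := restrictObj h N)
      (P := restrictObj h (self S) ⊗[R] restrictObj h N)
      ((TensorProduct.mk R (restrictObj h (self S)) (restrictObj h N) (1 : S)).toAddMonoidHom.comp
        (TensorProduct.lift (actBilin h N)).toAddMonoidHom)
      (AddMonoidHom.id (restrictObj h (self S) ⊗[R] restrictObj h N))
      (fun s x => ?_) t
    refine (H.tmul_act (self S) N s (1 : S) x).trans ?_
    exact congrArg (fun a : restrictObj h (self S) => a ⊗ₜ[R] x) (mul_one (M := S) s)
  exact Function.LeftInverse.injective key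

/-- Multiplication `S ⊗_R S → S` takes `1 ⊗ s` and `s ⊗ 1` to the same element, so that they are
equal as soon as it is injective. -/
theorem isIso_counit_app_self_iff :
    IsIso ((extendRestrictAdj h).counit.app (self S)) ↔ OneTmulEqTmulOne h := by
  constructor
  · intro hs s
    refine ((isIso_iff_bijective _).1 hs).1 ?_
    exact (one_mul (M := S) s).trans (mul_one (M := S) s).symm
  · intro H
    have := H.isIso_sigma
    exact inferInstanceAs (IsIso ((sigma h).app (self S)))

theorem isIso_counit_iff : IsIso (extendRestrictAdj h).counit ↔ OneTmulEqTmulOne h :=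
  ⟨fun _ => isIso_counit_app_self_iff.1 inferInstance, fun H => H.isIso_sigma⟩

/-- In the adjoint triple `h^* ⊣ h_* ⊣ h~`, both conditions say that `h_*` is fully faithful. -/
theorem isIso_unit_iff : IsIso (restrictCoextendAdj h).unit ↔ OneTmulEqTmulOne h := by
  rw [← isIso_counit_iff]
  constructor
  · intro _
    have hf := (restrictCoextendAdj h).fullyFaithfulLOfIsIsoUnit
    have := hf.full
    have := hf.faithful
    infer_instance
  · intro _
    have hf := (extendRestrictAdj h).fullyFaithfulROfIsIsoCounit
    have := hf.full
    have := hf.faithful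
    infer_instance

/-! ### Tensor products and graded modules of homomorphisms -/

/-- Under `OneTmulEqTmulOne`, the tensor product over `R` is balanced over `S`, which yields a map
from the tensor product over `S` back to the one over `R`. Conversely, `1 ⊗ s` and `s ⊗ 1` agree
in `S ⊗_S S`. -/
theorem isIso_gamma_iff : IsIso (gamma h) ↔ OneTmulEqTmulOne h := by
  constructor
  · intro _ s
    have hi : IsIso ((gamma h).app (self S, self S)) := inferInstance
    refine ((isIso_iff_bijective _).1 hi).1 ?_
    have key : ∀ t : S, (1 : S) ⊗ₜ[S] t = t ⊗ₜ[S] (1 : S) := fun t => by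
      rw [← mul_one t, ← smul_eq_mul, TensorProduct.smul_tmul]
    exact key s
  · intro H
    rw [NatTrans.isIso_iff_isIso_app]
    rintro ⟨M, N⟩
    rw [isIso_iff_bijective]
    let B : M →+ N →+ (restrictObj h M ⊗[R] restrictObj h N) :=
      AddMonoidHom.mk' (fun x => AddMonoidHom.mk' (fun y =>
          (show restrictObj h M from x) ⊗ₜ[R] (show restrictObj h N from y))
        (fun y y' => TensorProduct.tmul_add (R := R) (M := restrictObj h M)
          (N := restrictObj h N) x y y'))
        (fun x x' => AddMonoidHom.ext fun y => TensorProduct.add_tmul (R := R)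
          (M := restrictObj h M) (N := restrictObj h N) x x' y)
    let k : M ⊗[S] N →+ restrictObj h M ⊗[R] restrictObj h N :=
      TensorProduct.liftAddHom B fun s x y => (H.tmul_act M N s x y).symm
    refine Function.bijective_iff_has_inverse.2 ⟨k, fun t => ?_, fun t => ?_⟩
    · exact tensor_congr (M := restrictObj h M) (N := restrictObj h N)
        (P := restrictObj h M ⊗[R] restrictObj h N)
        (k.comp (TensorProduct.lift (gammaBilin h M N)).toAddMonoidHom)
        (AddMonoidHom.id (restrictObj h M ⊗[R] restrictObj h N)) (fun _ _ => rfl) t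
    · exact tensor_congr (M := M) (N := N) (P := M ⊗[S] N)
        (AddMonoidHom.comp (TensorProduct.lift (gammaBilin h M N)).toAddMonoidHom k)
        (AddMonoidHom.id (M ⊗[S] N)) (fun _ _ => rfl) t

theorem OneTmulEqTmulOne.isIso_eta (H : OneTmulEqTmulOne h) : IsIso (eta h) := by
  rw [NatTrans.isIso_iff_isIso_app]
  rintro ⟨M, N⟩
  obtain ⟨M⟩ := M
  rw [isIso_iff_bijective]
  constructor
  · intro u w huw
    exact Subtype.ext (LinearMap.ext fun x => LinearMap.congr_fun (congrArg Subtype.val huw) x)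
  -- A sum of homogeneous `R`-linear maps has to be lifted to a sum of homogeneous `S`-linear maps,
  -- so `S`-linearity is used for the homogeneous summands.
  · have hle : homSum (R := R) (restrictObj h M).deg (restrictObj h N).deg ≤
        (homSum (R := S) M.deg N.deg).map (restrictLin h M N) := by
      refine iSup_le fun g u hu => ?_
      refine ⟨{ toFun := u, map_add' := u.map_add, map_smul' := H.map_act u }, ?_, rfl⟩
      exact homDeg_le_homSum M.deg N.deg g hu
    rintro ⟨u, hu⟩
    obtain ⟨w, hw, rfl⟩ := hle hu
    exact ⟨⟨w, hw⟩, rfl⟩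

/-- The map `s ↦ 1 ⊗ s` from `S` to `S ⊗_R S`, where `S` acts on the first factor, is `R`-linear of
degree `0`. If it is `S`-linear, then it takes `s` to `s • (1 ⊗ 1) = s ⊗ 1`. -/
theorem oneTmulEqTmulOne_of_isIso_etaLeft [IsIso (etaLeft h (self S))] : OneTmulEqTmulOne h := by
  intro s
  let E : GrMod S := extendObj h (restrictObj h (self S))
  have hi : IsIso ((etaLeft h (self S)).app E) := inferInstance
  let ρ : restrictObj h (self S) ⟶ restrictObj h E := (rho h).app (restrictObj h (self S))
  have hρ : ρ.toLin ∈ homSum (R := R) (restrictObj h (self S)).deg (restrictObj h E).deg :=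
    homDeg_le_homSum _ _ 0 fun i x hx => by
      rw [add_zero]
      exact ρ.map_mem i x hx
  obtain ⟨w, hw⟩ := ((isIso_iff_bijective _).1 hi).2 ⟨ρ.toLin, hρ⟩
  have hw' : ∀ x : S, w.1 x = ρ.toLin x := LinearMap.congr_fun (congrArg Subtype.val hw)
  have h1 : w.1 (act (self S) s (1 : S)) = act E s (w.1 (1 : S)) := w.1.map_smul s (1 : S)
  replace h1 := (hw' _).symm.trans (h1.trans (congrArg (act E s) (hw' 1)))
  have h2 : (show restrictObj h (self S) from (1 : S)) ⊗ₜ[R]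
        (show restrictObj h (self S) from act (self S) s (1 : S)) =
      (show restrictObj h (self S) from act (self S) s (1 : S)) ⊗ₜ[R]
        (show restrictObj h (self S) from (1 : S)) := h1
  have h3 : (show restrictObj h (self S) from act (self S) s (1 : S)) = s := mul_one (M := S) s
  rwa [h3] at h2

theorem isIso_eta_iff : IsIso (eta h) ↔ OneTmulEqTmulOne h := by
  refine ⟨fun _ => ?_, fun H => H.isIso_eta⟩
  have : IsIso (etaLeft h (self S)) := by unfold etaLeft; infer_instance
  exact oneTmulEqTmulOne_of_isIso_etaLeft

theorem isIso_etaLeft_iff : IsIso (etaLeft h (self S)) ↔ OneTmulEqTmulOne h := by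
  refine ⟨fun _ => oneTmulEqTmulOne_of_isIso_etaLeft, fun H => ?_⟩
  have := H.isIso_eta
  unfold etaLeft
  infer_instance

end ChangeOfRings

end GrMod

theorem mainTheorem1 {G : Type v} [AddCommGroup G] [DecidableEq G] {R S : GrRing.{v, u} G}
    (h : R ⟶ S) :
    List.TFAE [
      Epi h,
      IsIso ((GrMod.extendRestrictAdj h).counit.app (GrMod.self S)),
      IsIso (GrMod.extendRestrictAdj h).counit,
      IsIso (GrMod.restrictCoextendAdj h).unit,
      IsIso (GrMod.gamma h),
      IsIso (GrMod.eta h),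
      IsIso (GrMod.etaLeft h (GrMod.self S))] := by
  refine List.tfae_of_forall (GrMod.OneTmulEqTmulOne h) _ ?_
  simp only [List.forall_mem_cons, List.not_mem_nil, false_imp_iff, implies_true, and_true]
  exact ⟨GrMod.epi_iff_oneTmulEqTmulOne, GrMod.isIso_counit_app_self_iff, GrMod.isIso_counit_iff,
    GrMod.isIso_unit_iff, GrMod.isIso_gamma_iff, GrMod.isIso_eta_iff, GrMod.isIso_etaLeft_iff⟩
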